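/- **Setting.** Let $d\ge 1$, let $\Omega\subset\mathbb R^d$ be a bounded open set and let $a$ be a measurable field of symmetric $d\times d$ matrices on $\Omega$ with $\lambda_{\min}|l|^2\le l^Ta(x)l\le\lambda_{\max}|l|^2$ for all $x\in\Omega$, $l\in\mathbb R^d$, where $\lambda_{\min}>0$. Let $H^1_0(\Omega)$ be the closure of $C_c^\infty(\Omega)$ in the $H^1$-norm, $H^{-1}(\Omega)$ its dual, $\langle u,w\rangle_a=\int_\Omega(\nabla u)^Ta\nabla w$, $\|u\|_a=\langle u,u\rangle_a^{1/2}$, and let $\mathcal L=-\operatorname{div}(a\nabla\cdot):H^1_0(\Omega)\to H^{-1}(\Omega)$, i.e. $\int_\Omega h\,\mathcal Lu=\langle u,h\rangle_a$. *Measurements.* Let $\mathcal I$ be a finite set of $q$-tuples, and for $1\le k\le q$ let $\mathcal I^{(k)}$ be the set of truncations $i^{(k)}=(i_1,\dots,i_k)$ of its elements. Let $\delta\in(0,1)$ and $0<H_q<\dots<H_1<1$. For $1\le k\le q$ let $(\tau_i^{(k)})_{i\in\mathcal I^{(k)}}$ be a partition of $\Omega$ into convex sets of diameter at most $H_k$,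 each containing a ball of diameter $\delta H_k$, and suppose that $\tau_i^{(k)}=\bigcup_{j\in\mathcal I^{(k+1)},\,j^{(k)}=i}\tau_j^{(k+1)}$ for $1\le k<q$ and $i\in\mathcal I^{(k)}$. Let $\phi_i^{(k)}$ be the indicator function of $\tau_i^{(k)}$. *Gamblets.* $\psi_i^{(k)}$ denotes the minimizer of $\|\psi\|_a$ over all $\psi\in H^1_0(\Omega)$ with $\int_\Omega\phi_j^{(k)}\psi=\delta_{i,j}$ for all $j\in\mathcal I^{(k)}$. *Random field.* Let $\xi$ be a centered Gaussian field with covariance operator $\mathcal L$: the variables $\int_\Omega f\xi$, $f\in H^1_0(\Omega)$, are jointly Gaussian and centered with covariance $\operatorname{Cov}(\int_\Omega f\xi,\int_\Omega g\xi)=\langle f,g\rangle_a$. Let $v$ be the solution of $-\operatorname{div}(a\nabla v)=\xi$ in $\Omega$, $v=0$ on $\partial\Omega$: $v$ is a generalized random field, that is, a random linear functional $g\mapsto\int_\Omega vg$ on $H^{-1}(\Omega)$ (each $\int_\Omega vg$ is a random variable, and for each realization $\int_\Omega vg$ is linear in $g$), with $\int_\Omega v\,\mathcal Lu=\int_\Omega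 u\,\xi$ almost surely for every $u\in H^1_0(\Omega)$. For $1\le k\le q$ let $\mathcal F_k$ be the $\sigma$-algebra generated by $(\int_\Omega v\phi_i^{(k)})_{i\in\mathcal I^{(k)}}$ and let $$v^{(k)}:=\sum_{i\in\mathcal I^{(k)}}\psi_i^{(k)}\int_\Omega v\,\phi_i^{(k)},$$ a random element of $H^1_0(\Omega)$. **Theorem.** Each gamblet $\psi_i^{(k)}$ exists and is unique, and: 0. $v^{(k)}=\mathbb E[v\mid\mathcal F_k]$ for $1\le k\le q$, i.e. for every $f\in H^{-1}(\Omega)$ the variable $\int_\Omega vf$ is integrable and $\mathbb E[\int_\Omega vf\mid\mathcal F_k]=\int_\Omega v^{(k)}f$ almost surely. 1. $\mathcal F_1\subset\dots\subset\mathcal F_q$, i.e. $(\mathcal F_k)_{1\le k\le q}$ is a filtration. 2. $(v^{(k)})_{1\le k\le q}$ is a martingale with respect to $(\mathcal F_k)$, i.e. $(\int_\Omega v^{(k)}f)_{1\le k\le q}$ is a martingale for every $f\in H^{-1}(\Omega)$. 3. $v^{(1)}$ and the increments $v^{(k+1)}-v^{(k)}$, $1\le k<q$, are Gaussian fields (indexed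 by $f\in H^{-1}(\Omega)$) and they are independent. 4. (Pointwise values.) Choose any pointwise representatives of the gamblets and let $v^{(k)}(x)=\sum_{i\in\mathcal I^{(k)}}\psi_i^{(k)}(x)\int_\Omega v\phi_i^{(k)}$. There is a Lebesgue-null set $N$, containing no point of $\Omega$ at which all the chosen representatives are continuous, such that $(v^{(k)}(x))_{1\le k\le q}$ is a martingale with respect to $(\mathcal F_k)$ for every $x\in\Omega\setminus N$, and such that $v^{(1)}$ and the increments $v^{(k+1)}-v^{(k)}$, as random fields indexed by $x\in\Omega\setminus N$, are independent Gaussian fields. In particular, if the representatives are continuous on $\Omega$, this holds for every $x\in\Omega$. -/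

import Mathlib

open MeasureTheory ProbabilityTheory
open scoped ContDiff

noncomputable section

namespace Gamblets

/-! ### The space `H¹₀(Ω)`, the energy form and the operator `-div (a ∇ ·)` -/

/-- Pairs `(φ, ∇φ)` with `φ ∈ C_c^∞(Ω)`, as elements of `L²(Ω) × L²(Ω; ℝ^d)`. -/
def testPairs {d : ℕ} (Ω : Set (EuclideanSpace ℝ (Fin d))) :
    Set (WithLp 2 (Lp ℝ 2 (volume.restrict Ω) ×
      Lp (EuclideanSpace ℝ (Fin d)) 2 (volume.restrict Ω))) :=
  {p | ∃ φ : EuclideanSpace ℝ (Fin d) → ℝ,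
    ContDiff ℝ ∞ φ ∧ HasCompactSupport φ ∧ tsupport φ ⊆ Ω ∧
    p.fst =ᵐ[volume.restrict Ω] φ ∧ p.snd =ᵐ[volume.restrict Ω] gradient φ}

/-- `H¹₀(Ω)`: the closure of `C_c^∞(Ω)` in the `H¹`-norm. An element is stored as the pair
`(u, ∇u)` of a function and its weak gradient. -/
abbrev H10 {d : ℕ} (Ω : Set (EuclideanSpace ℝ (Fin d))) :
    Submodule ℝ (WithLp 2 (Lp ℝ 2 (volume.restrict Ω) ×
      Lp (EuclideanSpace ℝ (Fin d)) 2 (volume.restrict Ω))) :=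
  (Submodule.span ℝ (testPairs Ω)).topologicalClosure

/-- The function (class) underlying an element of `H¹₀(Ω)`. -/
def valFn {d : ℕ} {Ω : Set (EuclideanSpace ℝ (Fin d))} (u : H10 Ω) :
    Lp ℝ 2 (volume.restrict Ω) :=
  u.1.fst

/-- The weak gradient of an element of `H¹₀(Ω)`. -/
def gradFn {d : ℕ} {Ω : Set (EuclideanSpace ℝ (Fin d))} (u : H10 Ω) :
    Lp (EuclideanSpace ℝ (Fin d)) 2 (volume.restrict Ω) :=
  u.1.snd

/-- `H⁻¹(Ω)`, the dual of `H¹₀(Ω)`. -/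
abbrev HMinus1 {d : ℕ} (Ω : Set (EuclideanSpace ℝ (Fin d))) : Type :=
  StrongDual ℝ (H10 Ω)

/-- The embedding `L²(Ω) → H⁻¹(Ω)`: the functional `h ↦ ∫_Ω φ h`. -/
def ofL2 {d : ℕ} (Ω : Set (EuclideanSpace ℝ (Fin d)))
    (φ : Lp ℝ 2 (volume.restrict Ω)) : HMinus1 Ω :=
  (innerSL ℝ φ).comp ((WithLp.fstL 2 ℝ (Lp ℝ 2 (volume.restrict Ω))
    (Lp (EuclideanSpace ℝ (Fin d)) 2 (volume.restrict Ω))).comp (H10 Ω).subtypeL)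

open Classical in
/-- The functional `h ↦ ∫_s h` of `H⁻¹(Ω)` given by the indicator function of `s`
(as soon as this indicator function is in `L²(Ω)`, in particular for bounded convex `s`). -/
def indicatorFunctional {d : ℕ} (Ω s : Set (EuclideanSpace ℝ (Fin d))) : HMinus1 Ω :=
  if h : MemLp (s.indicator fun _ => (1 : ℝ)) 2 (volume.restrict Ω) then
    ofL2 Ω (h.toLp _)
  else 0

/-- `a` is a symmetric, uniformly elliptic matrix field on `Ω`, with measurable entries and with
`lmin |l|² ≤ lᵀ a(x) l ≤ lmax |l|²`; in particular its entries are in `L^∞(Ω)`. -/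
structure IsUniformlyElliptic {d : ℕ} (Ω : Set (EuclideanSpace ℝ (Fin d)))
    (a : EuclideanSpace ℝ (Fin d) → Matrix (Fin d) (Fin d) ℝ) (lmin lmax : ℝ) : Prop where
  measurable : ∀ i j, AEStronglyMeasurable (fun x => a x i j) (volume.restrict Ω)
  symm : ∀ x ∈ Ω, (a x).IsSymm
  lmin_pos : 0 < lmin
  lower : ∀ x ∈ Ω, ∀ l : Fin d → ℝ, lmin * (l ⬝ᵥ l) ≤ l ⬝ᵥ (a x).mulVec l
  upper : ∀ x ∈ Ω, ∀ l : Fin d → ℝ, l ⬝ᵥ (a x).mulVec l ≤ lmax * (l ⬝ᵥ l)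

/-- The energy scalar product `⟨u, w⟩_a = ∫_Ω (∇u)ᵀ a ∇w`. -/
def energy {d : ℕ} (Ω : Set (EuclideanSpace ℝ (Fin d)))
    (a : EuclideanSpace ℝ (Fin d) → Matrix (Fin d) (Fin d) ℝ) (u w : H10 Ω) : ℝ :=
  ∫ x in Ω, (gradFn u x).ofLp ⬝ᵥ (a x).mulVec (gradFn w x).ofLp

/-- The energy norm `‖u‖_a`. -/
def energyNorm {d : ℕ} (Ω : Set (EuclideanSpace ℝ (Fin d)))
    (a : EuclideanSpace ℝ (Fin d) → Matrix (Fin d) (Fin d) ℝ) (u : H10 Ω) : ℝ :=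
  Real.sqrt (energy Ω a u u)

/-- `-div (a ∇u) = g` in `H⁻¹(Ω)`, for `u ∈ H¹₀(Ω)`. -/
def IsWeakSolution {d : ℕ} (Ω : Set (EuclideanSpace ℝ (Fin d)))
    (a : EuclideanSpace ℝ (Fin d) → Matrix (Fin d) (Fin d) ℝ)
    (u : H10 Ω) (g : HMinus1 Ω) : Prop :=
  ∀ h : H10 Ω, energy Ω a u h = g h

/-! ### The Gaussian forcing and the SPDE -/

/-- `ξ` is a centered Gaussian field with covariance operator `𝓛 = -div (a ∇ ·)`: the random
variables `ξ f`, standing for `∫_Ω f ξ` with `f ∈ H¹₀(Ω)`, are jointly Gaussian, centered, and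
have covariance `∫_Ω f 𝓛 g = ⟨f, g⟩_a`. -/
structure IsGaussianForcing {d : ℕ} (Ω : Set (EuclideanSpace ℝ (Fin d)))
    (a : EuclideanSpace ℝ (Fin d) → Matrix (Fin d) (Fin d) ℝ)
    {S : Type*} [MeasurableSpace S] (P : Measure S) (ξ : H10 Ω → S → ℝ) : Prop where
  gaussian : IsGaussianProcess ξ P
  mean : ∀ f, ∫ s, ξ f s ∂P = 0
  cov : ∀ f g, cov[ξ f, ξ g; P] = energy Ω a f g

/-- `v` is the solution of `-div (a ∇v) = ξ` in `Ω`, `v = 0` on `∂Ω`. It is a random linear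
functional on `H⁻¹(Ω)`, where `v g` stands for `∫_Ω v g`, and the equation is tested against all
`u ∈ H¹₀(Ω)`: by symmetry of `𝓛 = -div (a ∇ ·)` it reads `∫_Ω v 𝓛u = ∫_Ω u ξ`. -/
structure IsSPDESolution {d : ℕ} (Ω : Set (EuclideanSpace ℝ (Fin d)))
    (a : EuclideanSpace ℝ (Fin d) → Matrix (Fin d) (Fin d) ℝ)
    {S : Type*} [MeasurableSpace S] (P : Measure S) (ξ : H10 Ω → S → ℝ)
    (v : HMinus1 Ω → S → ℝ) : Prop where
  measurable : ∀ g, Measurable (v g)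
  linear : ∀ s, IsLinearMap ℝ fun g => v g s
  solves : ∀ (u : H10 Ω) (g : HMinus1 Ω), IsWeakSolution Ω a u g → v g =ᵐ[P] ξ u

/-! ### Nested measurement functions and gamblets -/

/-- `𝓘^(k)`, the truncations to length `k` of the elements of the index tree `I`, the tuples being
encoded as lists. -/
def level (I : Finset (List ℕ)) (k : ℕ) : Finset (List ℕ) :=
  I.image (List.take k)

/-- `I` is an index tree of depth `q`, and `τ k i`, for `1 ≤ k ≤ q` and `i ∈ 𝓘^(k)`, is a
hierarchy of nested partitions of `Ω` into convex cells, those of level `k` having diameter at most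
`H k` and containing a ball of diameter `δ * H k`. -/
structure IsNestedPartition {d : ℕ} (Ω : Set (EuclideanSpace ℝ (Fin d))) (q : ℕ)
    (I : Finset (List ℕ)) (δ : ℝ) (H : ℕ → ℝ)
    (τ : ℕ → List ℕ → Set (EuclideanSpace ℝ (Fin d))) : Prop where
  length_eq : ∀ i ∈ I, i.length = q
  delta_mem : δ ∈ Set.Ioo (0 : ℝ) 1
  H_mem : ∀ k ∈ Set.Icc 1 q, H k ∈ Set.Ioo (0 : ℝ) 1
  H_anti : StrictAntiOn H (Set.Icc 1 q)
  cover : ∀ k ∈ Set.Icc 1 q, ⋃ i ∈ level I k, τ k i = Ω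
  disjoint : ∀ k ∈ Set.Icc 1 q, (level I k : Set (List ℕ)).PairwiseDisjoint (τ k)
  convex : ∀ k ∈ Set.Icc 1 q, ∀ i ∈ level I k, Convex ℝ (τ k i)
  diam_le : ∀ k ∈ Set.Icc 1 q, ∀ i ∈ level I k, Metric.diam (τ k i) ≤ H k
  ball_subset : ∀ k ∈ Set.Icc 1 q, ∀ i ∈ level I k,
    ∃ c, Metric.ball c (δ * H k / 2) ⊆ τ k i
  nested : ∀ k, 1 ≤ k → k < q → ∀ i ∈ level I k,
    τ k i = ⋃ j ∈ (level I (k + 1)).filter (fun j => j.take k = i), τ (k + 1) j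

/-- The measurement function `φ_i^(k)`, the indicator function of `τ k i`, as an element of
`H⁻¹(Ω)`. -/
def meas {d : ℕ} (Ω : Set (EuclideanSpace ℝ (Fin d)))
    (τ : ℕ → List ℕ → Set (EuclideanSpace ℝ (Fin d))) (k : ℕ) (i : List ℕ) : HMinus1 Ω :=
  indicatorFunctional Ω (τ k i)

/-- `ψ` satisfies the constraints `∫_Ω φ_j^(k) ψ = δ_{i,j}` for `j ∈ 𝓘^(k)`. -/
def Admissible {d : ℕ} (Ω : Set (EuclideanSpace ℝ (Fin d))) (I : Finset (List ℕ))
    (τ : ℕ → List ℕ → Set (EuclideanSpace ℝ (Fin d))) (k : ℕ) (i : List ℕ) (ψ : H10 Ω) : Prop :=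
  ∀ j ∈ level I k, meas Ω τ k j ψ = if i = j then 1 else 0

/-- `ψ` minimizes the energy norm under the constraints `∫_Ω φ_j^(k) ψ = δ_{i,j}`. -/
def IsGamblet {d : ℕ} (Ω : Set (EuclideanSpace ℝ (Fin d)))
    (a : EuclideanSpace ℝ (Fin d) → Matrix (Fin d) (Fin d) ℝ) (I : Finset (List ℕ))
    (τ : ℕ → List ℕ → Set (EuclideanSpace ℝ (Fin d))) (k : ℕ) (i : List ℕ) (ψ : H10 Ω) : Prop :=
  Admissible Ω I τ k i ψ ∧
    ∀ χ : H10 Ω, Admissible Ω I τ k i χ → energyNorm Ω a ψ ≤ energyNorm Ω a χ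

/-- The σ-algebra `𝓕_k` generated by the random variables `∫_Ω v φ_i^(k)`, `i ∈ 𝓘^(k)`. -/
abbrev measSigma {d : ℕ} (Ω : Set (EuclideanSpace ℝ (Fin d))) (I : Finset (List ℕ))
    (τ : ℕ → List ℕ → Set (EuclideanSpace ℝ (Fin d))) {S : Type*} (v : HMinus1 Ω → S → ℝ)
    (k : ℕ) : MeasurableSpace S :=
  MeasurableSpace.comap (fun s (i : level I k) => v (meas Ω τ k i) s) inferInstance

/-- The random element `v^(k) = ∑_{i ∈ 𝓘^(k)} ψ_i^(k) ∫_Ω v φ_i^(k)` of `H¹₀(Ω)`. -/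
def vLevel {d : ℕ} (Ω : Set (EuclideanSpace ℝ (Fin d))) (I : Finset (List ℕ))
    (τ : ℕ → List ℕ → Set (EuclideanSpace ℝ (Fin d))) {S : Type*} (v : HMinus1 Ω → S → ℝ)
    (ψ : ℕ → List ℕ → H10 Ω) (k : ℕ) (s : S) : H10 Ω :=
  ∑ i ∈ level I k, v (meas Ω τ k i) s • ψ k i

/-- The value `v^(k)(x) = ∑_{i ∈ 𝓘^(k)} ψ_i^(k)(x) ∫_Ω v φ_i^(k)`, where `ψ k i` is a pointwise
representative of `ψ_i^(k)`. -/
def vPoint {d : ℕ} (Ω : Set (EuclideanSpace ℝ (Fin d))) (I : Finset (List ℕ))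
    (τ : ℕ → List ℕ → Set (EuclideanSpace ℝ (Fin d))) {S : Type*} (v : HMinus1 Ω → S → ℝ)
    (ψ : ℕ → List ℕ → EuclideanSpace ℝ (Fin d) → ℝ) (k : ℕ) (x : EuclideanSpace ℝ (Fin d))
    (s : S) : ℝ :=
  ∑ i ∈ level I k, ψ k i x * v (meas Ω τ k i) s

/-- For a sequence indexed by `1, …, q`: its first term for `k = 1`, and the increment
`X k - X (k - 1)` for `k ≥ 2`. -/
def increment {M : Type*} [Sub M] (X : ℕ → M) (k : ℕ) : M :=
  if k = 1 then X 1 else X k - X (k - 1)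

end Gamblets

end

open Gamblets

/-! Poincaré's inequality and ellipticity make the energy form coercive on `H10 Ω`, so `𝓛` is
invertible by Lax–Milgram. Almost surely `v g` equals `ξ` at `𝓛⁻¹ g`; hence `v` is a centered
Gaussian field with `cov (v f) (v g) = f (𝓛⁻¹ g)`, and probabilistic orthogonality becomes energy
orthogonality.

A gamblet is energy-orthogonal to everything the measurements annihilate. The gamblets of a level
therefore span the `𝓛⁻¹ φ_i`, and interpolation by them is exact on that span
(`IsDualBasis.interp_apply`). Thus the residual `v f - v (interp f)` is uncorrelated with the
measurements, and so independent of them by joint Gaussianity; this identifies `v^(k)` as the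
conditional expectation (`condExp_fieldSigma`).

Nested cells give nested spans of measurements, hence the filtration. The martingale property is the
tower property, and a later increment is uncorrelated with an earlier one as a difference of two
residuals (`cov_increment_of_lt`).

For point values, evaluation at `x` is replaced by a combination `F x` of the finest measurements.
It agrees with evaluation on all gamblets at almost every `x`, which reduces the last claim to the
field indexed by functionals. -/

namespace Gamblets

/-! ### Test functions and Poincaré's inequality -/

section

variable {d : ℕ} {Ω : Set (EuclideanSpace ℝ (Fin d))}

theorem hasCompactSupport_gradient {E : Type*} [NormedAddCommGroup E] [InnerProductSpace ℝ E]
    [CompleteSpace E] {φ : E → ℝ} (hc : HasCompactSupport φ) : HasCompactSupport (gradient φ) :=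
  (hc.fderiv (𝕜 := ℝ)).comp_left (g := (InnerProductSpace.toDual ℝ E).symm)
    (LinearIsometryEquiv.map_zero _)

/-- Poincaré's inequality for compactly supported functions. -/
theorem integral_sq_le_integral_norm_gradient_sq {E : Type*} [NormedAddCommGroup E]
    [InnerProductSpace ℝ E] [FiniteDimensional ℝ E] [MeasurableSpace E] [BorelSpace E]
    [Nontrivial E] (μ : Measure E) [μ.IsAddHaarMeasure] {R : ℝ} (hR : 0 ≤ R)
    {φ : E → ℝ} (hφ : ContDiff ℝ ∞ φ) (hc : HasCompactSupport φ)
    (hs : tsupport φ ⊆ Metric.closedBall 0 R) :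
    ∫ x, φ x ^ 2 ∂μ ≤ 4 * R ^ 2 * ∫ x, ‖gradient φ x‖ ^ 2 ∂μ := by
  obtain ⟨e, g, hge, he, hg⟩ : ∃ (e : E) (g : E →L[ℝ] ℝ), g e = 1 ∧ ‖e‖ = 1 ∧
      ∀ x, |g x| ≤ ‖x‖ := by
    obtain ⟨e, he⟩ := exists_norm_eq E zero_le_one
    refine ⟨e, innerSL ℝ e, ?_, he, fun x => ?_⟩
    · simp [he]
    · simpa [he] using abs_real_inner_le_norm e x
  have hφc : Continuous φ := hφ.continuous
  have hfc : Continuous (fderiv ℝ φ) := hφ.continuous_fderiv (by simp)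
  have hgc : Continuous (gradient φ) :=
    (InnerProductSpace.toDual ℝ E).symm.continuous.comp hfc
  have hdf : ∀ x, HasFDerivAt φ (fderiv ℝ φ x) x := fun x =>
    (hφ.differentiable (by simp) x).hasFDerivAt
  have hcg : HasCompactSupport (gradient φ) := hasCompactSupport_gradient hc
  have hve : Continuous fun x => fderiv ℝ φ x e := hfc.clm_apply continuous_const
  have i1 : Integrable (fun x => φ x * φ x) μ :=
    (hφc.mul hφc).integrable_of_hasCompactSupport hc.mul_right
  have i2 : Integrable (fun x => ‖gradient φ x‖ ^ 2) μ :=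
    Continuous.integrable_of_hasCompactSupport (by fun_prop)
    (by simp_rw [sq]; exact hcg.norm.mul_right)
  have i3 : Integrable (fun x => (2 * φ x * fderiv ℝ φ x e) * g x) μ := by
    refine Continuous.integrable_of_hasCompactSupport
      (((continuous_const.mul hφc).mul hve).mul g.continuous) ?_
    exact (hc.mul_left (f := fun _ => (2 : ℝ))).mul_right.mul_right
  have i4 : Integrable (fun x => (φ x * φ x) * g x) μ :=
    ((hφc.mul hφc).mul g.continuous).integrable_of_hasCompactSupport hc.mul_right.mul_right
  -- The linear function `g` has derivative 1 along `e`, so `∫ φ²` becomes `-∫ 2 φ (∂_e φ) g`.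
  have ibp := integral_bilinear_hasLineDerivAt_right_eq_neg_left_of_integrable (μ := μ)
    (f := fun x => φ x * φ x) (f' := fun x => 2 * φ x * fderiv ℝ φ x e) (g := g)
    (g' := fun _ => 1) (v := e) (B := ContinuousLinearMap.mul ℝ ℝ) i3
    (by simpa using i1) i4
    (fun x _ => by
      convert ((hdf x).mul (hdf x)).hasLineDerivAt e using 1
      · rfl
      · simp; ring)
    (fun x _ => by
      convert g.hasFDerivAt.hasLineDerivAt (x := x) e using 1
      exact hge.symm)
  simp only [ContinuousLinearMap.mul_apply', mul_one] at ibp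
  -- Young's inequality `-2 φ t ≤ φ²/2 + 2 t²` with `t = (∂_e φ) g`, where `|g| ≤ R` on the support
  -- of `φ`. The half of `φ²` is absorbed on the left, whence the constant `4 R²`.
  have key : ∫ x, φ x * φ x ∂μ ≤
      ∫ x, ((1 / 2) * (φ x * φ x) + 2 * R ^ 2 * ‖gradient φ x‖ ^ 2) ∂μ := by
    rw [ibp, ← integral_neg]
    refine integral_mono i3.neg ((i1.const_mul _).add (i2.const_mul _)) fun x => ?_
    by_cases hx : x ∈ tsupport φ
    · have hxR : ‖x‖ ≤ R := by simpa using hs hx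
      have h1 : |g x| ≤ R := by
        exact (hg x).trans hxR
      have h2 : |fderiv ℝ φ x e| ≤ ‖gradient φ x‖ := by
        have := (fderiv ℝ φ x).le_opNorm e
        simpa [he, gradient] using this
      have h3 : |fderiv ℝ φ x e * g x| ≤ R * ‖gradient φ x‖ := by
        rw [abs_mul, mul_comm]
        gcongr
      have h4 : |fderiv ℝ φ x e * g x| ^ 2 ≤ (R * ‖gradient φ x‖) ^ 2 := by gcongr
      rw [sq_abs] at h4
      simp only
      nlinarith [sq_nonneg (φ x + 2 * (fderiv ℝ φ x e * g x))]
    · rw [image_eq_zero_of_notMem_tsupport hx]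
      simp; positivity
  rw [integral_add (i1.const_mul _) (i2.const_mul _), integral_const_mul, integral_const_mul] at key
  simp only [sq (φ _)]
  linarith

theorem testPairs_add {p p' : WithLp 2 (Lp ℝ 2 (volume.restrict Ω) ×
      Lp (EuclideanSpace ℝ (Fin d)) 2 (volume.restrict Ω))}
    (hp : p ∈ testPairs Ω) (hp' : p' ∈ testPairs Ω) : p + p' ∈ testPairs Ω := by
  obtain ⟨φ, h1, h2, h3, h4, h5⟩ := hp
  obtain ⟨φ', h1', h2', h3', h4', h5'⟩ := hp'
  refine ⟨φ + φ', h1.add h1', h2.add h2', ?_, ?_, ?_⟩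
  · exact (tsupport_add φ φ').trans (Set.union_subset h3 h3')
  · exact (Lp.coeFn_add _ _).trans (h4.add h4')
  · refine (Lp.coeFn_add _ _).trans ((h5.add h5').trans (.of_forall fun x => ?_))
    simp only [gradient, Pi.add_apply]
    rw [fderiv_add (h1.differentiable (by simp) x) (h1'.differentiable (by simp) x), map_add]

theorem testPairs_smul (c : ℝ) {p : WithLp 2 (Lp ℝ 2 (volume.restrict Ω) ×
      Lp (EuclideanSpace ℝ (Fin d)) 2 (volume.restrict Ω))}
    (hp : p ∈ testPairs Ω) : c • p ∈ testPairs Ω := by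
  obtain ⟨φ, h1, h2, h3, h4, h5⟩ := hp
  refine ⟨c • φ, h1.const_smul c, h2.smul_left (f := fun _ => c), ?_, ?_, ?_⟩
  · exact (tsupport_smul_subset_right (fun _ => c) φ).trans h3
  · exact (Lp.coeFn_smul _ _).trans (h4.const_smul c)
  · refine (Lp.coeFn_smul _ _).trans ((h5.const_smul c).trans (.of_forall fun x => ?_))
    simp only [gradient, Pi.smul_apply]
    rw [fderiv_const_smul (h1.differentiable (by simp) x), map_smul]

/-- Test pairs already form a subspace, so taking the span in `H10` adds nothing, and closed
conditions on `H10 Ω` need only be checked on genuine test functions. -/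
theorem mem_testPairs_of_mem_span {p : WithLp 2 (Lp ℝ 2 (volume.restrict Ω) ×
      Lp (EuclideanSpace ℝ (Fin d)) 2 (volume.restrict Ω))}
    (hp : p ∈ Submodule.span ℝ (testPairs Ω)) : p ∈ testPairs Ω := by
  induction hp using Submodule.span_induction with
  | mem x h => exact h
  | zero =>
    refine ⟨0, contDiff_const, HasCompactSupport.zero, by simp [tsupport],
      Lp.coeFn_zero _ _ _, ?_⟩
    refine (Lp.coeFn_zero _ _ _).trans (.of_forall fun x => ?_)
    simp [gradient]
  | add x y _ _ hx hy => exact testPairs_add hx hy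
  | smul c x _ hx => exact testPairs_smul c hx

theorem norm_sq_eq_integral {α E : Type*} [MeasurableSpace α] {μ : Measure α}
    [NormedAddCommGroup E] [InnerProductSpace ℝ E] (f : Lp E 2 μ) :
    ‖f‖ ^ 2 = ∫ x, ‖f x‖ ^ 2 ∂μ := by
  rw [← real_inner_self_eq_norm_sq, L2.inner_def]
  simp

/-- Poincaré's inequality on `H¹₀(Ω)`. -/
theorem exists_norm_valFn_le (hd : 0 < d) (hΩb : Bornology.IsBounded Ω) :
    ∃ C : ℝ, 0 ≤ C ∧ ∀ u : H10 Ω, ‖valFn u‖ ≤ C * ‖gradFn u‖ := by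
  have : Nonempty (Fin d) := ⟨⟨0, hd⟩⟩
  obtain ⟨R, hR0, hR⟩ := hΩb.subset_closedBall_lt 0 0
  refine ⟨2 * R, by positivity, ?_⟩
  have key : ∀ p ∈ Submodule.span ℝ (testPairs Ω), ‖p.fst‖ ≤ 2 * R * ‖p.snd‖ := by
    intro p hp
    obtain ⟨φ, h1, h2, h3, h4, h5⟩ := mem_testPairs_of_mem_span hp
    refine abs_le_of_sq_le_sq' ?_ (by positivity) |>.2
    rw [mul_pow, norm_sq_eq_integral, norm_sq_eq_integral]
    have e1 : ∫ x in Ω, ‖p.fst x‖ ^ 2 = ∫ x, φ x ^ 2 := by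
      rw [← setIntegral_eq_integral_of_forall_compl_eq_zero (s := Ω) (f := fun x => φ x ^ 2)]
      · refine integral_congr_ae (h4.mono fun x hx => ?_)
        simp only [hx, Real.norm_eq_abs, sq_abs]
      · intro x hx
        simp [image_eq_zero_of_notMem_tsupport fun h => hx (h3 h)]
    have e2 : ∫ x in Ω, ‖p.snd x‖ ^ 2 = ∫ x, ‖gradient φ x‖ ^ 2 := by
      rw [← setIntegral_eq_integral_of_forall_compl_eq_zero (s := Ω)
        (f := fun x => ‖gradient φ x‖ ^ 2)]
      · refine integral_congr_ae (h5.mono fun x hx => ?_)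
        simp only [hx]
      · intro x hx
        have : x ∉ tsupport (fderiv ℝ φ) := fun h => hx (h3 (tsupport_fderiv_subset ℝ h))
        simp [gradient, image_eq_zero_of_notMem_tsupport this]
    rw [e1, e2]
    refine (integral_sq_le_integral_norm_gradient_sq volume hR0.le h1 h2 (h3.trans hR)).trans
      (le_of_eq (by ring))
  intro u
  have hcl : IsClosed {p : WithLp 2 (Lp ℝ 2 (volume.restrict Ω) ×
      Lp (EuclideanSpace ℝ (Fin d)) 2 (volume.restrict Ω)) | ‖p.fst‖ ≤ 2 * R * ‖p.snd‖} :=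
    isClosed_le (WithLp.fstL 2 ℝ (Lp ℝ 2 (volume.restrict Ω))
      (Lp (EuclideanSpace ℝ (Fin d)) 2 (volume.restrict Ω))).continuous.norm
      (continuous_const.mul (WithLp.sndL 2 ℝ (Lp ℝ 2 (volume.restrict Ω))
        (Lp (EuclideanSpace ℝ (Fin d)) 2 (volume.restrict Ω))).continuous.norm)
  exact closure_minimal key hcl u.2

end

/-! ### Boundedness and coercivity of the energy form -/

section

variable {d : ℕ} {Ω : Set (EuclideanSpace ℝ (Fin d))}
  {a : EuclideanSpace ℝ (Fin d) → Matrix (Fin d) (Fin d) ℝ} {lmin lmax : ℝ}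

theorem dotProduct_mulVec_symm {n : Type*} [Fintype n] {A : Matrix n n ℝ} (hA : A.IsSymm)
    (l m : n → ℝ) : l ⬝ᵥ A.mulVec m = m ⬝ᵥ A.mulVec l := by
  rw [Matrix.dotProduct_mulVec, ← Matrix.mulVec_transpose, hA.eq, dotProduct_comm]

/-- Polarization: nonnegativity of the form at `l + m` and `l - m` bounds the mixed term by half the
sum of the diagonal ones. -/
theorem abs_dotProduct_mulVec_le {n : Type*} [Fintype n] {A : Matrix n n ℝ} (hA : A.IsSymm)
    {C : ℝ} (h0 : ∀ l, 0 ≤ l ⬝ᵥ A.mulVec l) (hC : ∀ l, l ⬝ᵥ A.mulVec l ≤ C * (l ⬝ᵥ l))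
    (l m : n → ℝ) : |l ⬝ᵥ A.mulVec m| ≤ C / 2 * (l ⬝ᵥ l + m ⬝ᵥ m) := by
  have h1 := h0 (l + m)
  have h2 := h0 (l - m)
  simp only [Matrix.mulVec_add, Matrix.mulVec_sub, dotProduct_add, dotProduct_sub, add_dotProduct,
    sub_dotProduct, dotProduct_mulVec_symm hA m l] at h1 h2
  have h3 := hC l
  have h4 := hC m
  rw [abs_le]
  constructor <;> linarith

theorem ofLp_dotProduct_self (l : EuclideanSpace ℝ (Fin d)) : l.ofLp ⬝ᵥ l.ofLp = ‖l‖ ^ 2 := by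
  rw [EuclideanSpace.real_norm_sq_eq]
  simp [dotProduct, sq]

theorem integrable_norm_sq {α E : Type*} [MeasurableSpace α] {μ : Measure α}
    [NormedAddCommGroup E] (f : Lp E 2 μ) : Integrable (fun x => ‖f x‖ ^ 2) μ :=
  (Lp.memLp f).integrable_norm_pow (by simp)

theorem IsUniformlyElliptic.nonneg (ha : IsUniformlyElliptic Ω a lmin lmax)
    {x : EuclideanSpace ℝ (Fin d)} (hx : x ∈ Ω) (l : Fin d → ℝ) : 0 ≤ l ⬝ᵥ (a x).mulVec l :=
  (mul_nonneg ha.lmin_pos.le (by simpa using dotProduct_self_star_nonneg l)).trans (ha.lower x hx l)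

theorem IsUniformlyElliptic.integrable (ha : IsUniformlyElliptic Ω a lmin lmax)
    (hΩ : MeasurableSet Ω) (f g : Lp (EuclideanSpace ℝ (Fin d)) 2 (volume.restrict Ω)) :
    Integrable (fun x => (f x).ofLp ⬝ᵥ (a x).mulVec (g x).ofLp) (volume.restrict Ω) := by
  refine Integrable.mono' (((integrable_norm_sq f).add (integrable_norm_sq g)).const_mul (lmax / 2))
    ?_ ?_
  · have hcoord : ∀ (h : Lp (EuclideanSpace ℝ (Fin d)) 2 (volume.restrict Ω)) (i : Fin d),
        AEStronglyMeasurable (fun x => (h x).ofLp i) (volume.restrict Ω) := fun h i =>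
      (EuclideanSpace.proj (𝕜 := ℝ) i).continuous.comp_aestronglyMeasurable
        (Lp.aestronglyMeasurable h)
    simp only [dotProduct, Matrix.mulVec]
    exact Finset.aestronglyMeasurable_fun_sum _ fun i _ => (hcoord f i).mul
      (Finset.aestronglyMeasurable_fun_sum _ fun j _ => (ha.measurable i j).mul (hcoord g j))
  · filter_upwards [ae_restrict_mem hΩ] with x hx
    rw [Real.norm_eq_abs]
    refine (abs_dotProduct_mulVec_le (ha.symm x hx) (ha.nonneg hx) (ha.upper x hx) _ _).trans ?_
    rw [ofLp_dotProduct_self, ofLp_dotProduct_self]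
    rfl

theorem energy_comm (ha : IsUniformlyElliptic Ω a lmin lmax) (hΩ : MeasurableSet Ω)
    (u w : H10 Ω) : energy Ω a u w = energy Ω a w u :=
  integral_congr_ae <| (ae_restrict_mem hΩ).mono fun x hx =>
    dotProduct_mulVec_symm (ha.symm x hx) _ _

theorem energy_add_left (ha : IsUniformlyElliptic Ω a lmin lmax) (hΩ : MeasurableSet Ω)
    (u u' w : H10 Ω) : energy Ω a (u + u') w = energy Ω a u w + energy Ω a u' w := by
  unfold energy
  rw [← integral_add (ha.integrable hΩ _ _) (ha.integrable hΩ _ _)]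
  refine integral_congr_ae ?_
  filter_upwards [Lp.coeFn_add (gradFn u) (gradFn u')] with x hx
  have : gradFn (u + u') x = gradFn u x + gradFn u' x := hx
  rw [this, WithLp.ofLp_add, add_dotProduct]

theorem energy_smul_left (c : ℝ) (u w : H10 Ω) :
    energy Ω a (c • u) w = c * energy Ω a u w := by
  unfold energy
  rw [← integral_const_mul]
  refine integral_congr_ae ?_
  filter_upwards [Lp.coeFn_smul c (gradFn u)] with x hx
  have : gradFn (c • u) x = c • gradFn u x := hx
  rw [this, WithLp.ofLp_smul, smul_dotProduct, smul_eq_mul]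

theorem le_energy_self (ha : IsUniformlyElliptic Ω a lmin lmax) (hΩ : MeasurableSet Ω)
    (u : H10 Ω) : lmin * ‖gradFn u‖ ^ 2 ≤ energy Ω a u u := by
  rw [norm_sq_eq_integral, ← integral_const_mul]
  refine integral_mono_ae ((integrable_norm_sq _).const_mul _) (ha.integrable hΩ _ _) ?_
  filter_upwards [ae_restrict_mem hΩ] with x hx
  simpa only [ofLp_dotProduct_self] using ha.lower x hx (gradFn u x).ofLp

theorem energy_self_le (ha : IsUniformlyElliptic Ω a lmin lmax) (hΩ : MeasurableSet Ω)
    (u : H10 Ω) : energy Ω a u u ≤ lmax * ‖gradFn u‖ ^ 2 := by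
  rw [norm_sq_eq_integral, ← integral_const_mul]
  refine integral_mono_ae (ha.integrable hΩ _ _) ((integrable_norm_sq _).const_mul _) ?_
  filter_upwards [ae_restrict_mem hΩ] with x hx
  simpa only [ofLp_dotProduct_self] using ha.upper x hx (gradFn u x).ofLp

theorem norm_sq_eq_valFn_add_gradFn (u : H10 Ω) :
    ‖u‖ ^ 2 = ‖valFn u‖ ^ 2 + ‖gradFn u‖ ^ 2 := by
  have h : ‖u‖ = ‖u.1‖ := rfl
  rw [h, WithLp.prod_norm_sq_eq_of_L2]
  rfl

/-- Cauchy–Schwarz for a nonnegative symmetric form turns the diagonal upper bound into continuity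
of the bilinear form. -/
theorem exists_coercive_bilin {V : Type*} [NormedAddCommGroup V] [InnerProductSpace ℝ V]
    (E : V → V → ℝ) (hadd : ∀ u u' w, E (u + u') w = E u w + E u' w)
    (hsmul : ∀ (c : ℝ) u w, E (c • u) w = c * E u w) (hsymm : ∀ u w, E u w = E w u)
    (hnn : ∀ u, 0 ≤ E u u) {C : ℝ} (hC0 : 0 ≤ C) (hC : ∀ u, E u u ≤ C * ‖u‖ ^ 2)
    {c : ℝ} (hc0 : 0 < c) (hc : ∀ u, c * ‖u‖ ^ 2 ≤ E u u) :
    ∃ B : V →L[ℝ] V →L[ℝ] ℝ, IsCoercive B ∧ ∀ u w, B u w = E u w := by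
  let B₀ : V →ₗ[ℝ] V →ₗ[ℝ] ℝ := LinearMap.mk₂ ℝ E hadd hsmul
    (fun u w w' => by rw [hsymm, hadd, hsymm w, hsymm w'])
    (fun c u w => by rw [hsymm, hsmul, hsymm w, smul_eq_mul])
  have hbound : ∀ u w, ‖B₀ u w‖ ≤ C * ‖u‖ * ‖w‖ := fun u w => by
    rw [Real.norm_eq_abs]
    refine abs_le_of_sq_le_sq ?_ (by positivity)
    have h := LinearMap.BilinForm.apply_sq_le_of_symm B₀ hnn ⟨fun u w => hsymm u w⟩ u w
    calc B₀ u w ^ 2 ≤ B₀ u u * B₀ w w := h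
      _ ≤ (C * ‖u‖ ^ 2) * (C * ‖w‖ ^ 2) :=
        mul_le_mul (hC u) (hC w) (hnn w) (by positivity)
      _ = (C * ‖u‖ * ‖w‖) ^ 2 := by ring
  refine ⟨B₀.mkContinuous₂ _ hbound, ⟨c, hc0, fun u => ?_⟩, fun u w => rfl⟩
  rw [mul_assoc, ← sq]
  exact hc u

set_option maxHeartbeats 1000000 in
/-- The energy scalar product is a bounded and coercive bilinear form on `H¹₀(Ω)`. -/
theorem exists_coercive_energy (hd : 0 < d) (hΩ : MeasurableSet Ω) (hΩb : Bornology.IsBounded Ω)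
    (ha : IsUniformlyElliptic Ω a lmin lmax) :
    ∃ B : H10 Ω →L[ℝ] H10 Ω →L[ℝ] ℝ, IsCoercive B ∧ ∀ u w, B u w = energy Ω a u w := by
  -- The absolute value matters for empty `Ω`, where `lmax` may be negative.
  have hle : ∀ u : H10 Ω, energy Ω a u u ≤ |lmax| * ‖u‖ ^ 2 := fun u => by
    refine (energy_self_le ha hΩ u).trans
      (mul_le_mul (le_abs_self _) ?_ (sq_nonneg _) (abs_nonneg _))
    rw [norm_sq_eq_valFn_add_gradFn]
    exact le_add_of_nonneg_left (sq_nonneg _)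
  obtain ⟨C, hC0, hC⟩ := exists_norm_valFn_le hd hΩb
  refine exists_coercive_bilin (energy Ω a) (energy_add_left ha hΩ)
    energy_smul_left (energy_comm ha hΩ)
    (fun u => (mul_nonneg ha.lmin_pos.le (sq_nonneg _)).trans (le_energy_self ha hΩ u))
    (abs_nonneg lmax) hle (c := lmin / (C ^ 2 + 1)) (div_pos ha.lmin_pos (by positivity))
    fun u => le_trans ?_ (le_energy_self ha hΩ u)
  have h1 : ‖u‖ ^ 2 ≤ (C ^ 2 + 1) * ‖gradFn u‖ ^ 2 := by
    rw [norm_sq_eq_valFn_add_gradFn]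
    have := pow_le_pow_left₀ (norm_nonneg _) (hC u) 2
    linarith
  rw [div_mul_eq_mul_div, div_le_iff₀ (by positivity), mul_assoc]
  exact mul_le_mul_of_nonneg_left (by linarith) ha.lmin_pos.le

end

/-! ### Quadratic minimization under finitely many linear constraints -/

section Minimizers

variable {V ι : Type*} [NormedAddCommGroup V] [InnerProductSpace ℝ V]
  {B : V →L[ℝ] V →L[ℝ] ℝ}

theorem _root_.IsCoercive.eq_zero (hB : IsCoercive B) {u : V} (hu : B u u = 0) : u = 0 := by
  obtain ⟨C, hC0, hC⟩ := hB
  have h := hC u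
  rw [hu] at h
  by_contra hne
  have := norm_pos_iff.2 hne
  exact absurd h (not_le.2 (by positivity))

theorem _root_.IsCoercive.nonneg (hB : IsCoercive B) (u : V) : 0 ≤ B u u := by
  obtain ⟨C, hC0, hC⟩ := hB
  exact le_trans (by positivity) (hC u)

/-- The Lax–Milgram theorem: solvability of the variational equation. -/
theorem _root_.IsCoercive.exists_forall_eq [CompleteSpace V] (hB : IsCoercive B)
    (f : StrongDual ℝ V) : ∃ u, ∀ h, B u h = f h := by
  refine ⟨hB.continuousLinearEquivOfBilin.symm ((InnerProductSpace.toDual ℝ V).symm f),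
    fun h => ?_⟩
  rw [← hB.continuousLinearEquivOfBilin_apply, ContinuousLinearEquiv.apply_symm_apply,
    InnerProductSpace.toDual_symm_apply]

/-- The elements of `V` annihilated by the measurements `φ j`, `j ∈ s`. -/
def annihilator (s : Finset ι) (φ : ι → StrongDual ℝ V) : Submodule ℝ V :=
  ⨅ j ∈ s, LinearMap.ker (φ j : V →ₗ[ℝ] ℝ)

theorem mem_annihilator {s : Finset ι} {φ : ι → StrongDual ℝ V} {χ : V} :
    χ ∈ annihilator s φ ↔ ∀ j ∈ s, φ j χ = 0 := by
  simp [annihilator, Submodule.mem_iInf]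

theorem isClosed_annihilator (s : Finset ι) (φ : ι → StrongDual ℝ V) :
    IsClosed (annihilator s φ : Set V) := by
  have : (annihilator s φ : Set V) = ⋂ j ∈ s, {χ | φ j χ = 0} := by
    ext χ; simp [mem_annihilator]
  rw [this]
  exact isClosed_biInter fun j _ => isClosed_eq (φ j).continuous continuous_const

/-- First variation: `ψ + t • χ` stays feasible, so a quadratic in `t` without constant term is
nonnegative everywhere; its discriminant forces the linear coefficient to vanish. -/
theorem minimizer_orthogonal (hsymm : ∀ u w, B u w = B w u)
    {s : Finset ι} {φ : ι → StrongDual ℝ V} {c : ι → ℝ} {ψ : V} (hψ : ∀ j ∈ s, φ j ψ = c j)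
    (hmin : ∀ χ, (∀ j ∈ s, φ j χ = c j) → B ψ ψ ≤ B χ χ) {χ : V} (hχ : χ ∈ annihilator s φ) :
    B ψ χ = 0 := by
  rw [mem_annihilator] at hχ
  have key : ∀ t : ℝ, 0 ≤ B χ χ * (t * t) + 2 * B ψ χ * t + 0 := fun t => by
    have h := hmin (ψ + t • χ) fun j hj => by simp [hψ j hj, hχ j hj]
    simp only [map_add, map_smul, add_apply, smul_apply, smul_eq_mul, hsymm χ ψ] at h
    linarith
  have := discrim_le_zero key
  rw [discrim] at this
  nlinarith [sq_nonneg (B ψ χ)]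

theorem minimizer_of_orthogonal (hB : IsCoercive B) (hsymm : ∀ u w, B u w = B w u)
    {s : Finset ι} {φ : ι → StrongDual ℝ V} {c : ι → ℝ} {ψ : V} (hψ : ∀ j ∈ s, φ j ψ = c j)
    (horth : ∀ χ ∈ annihilator s φ, B ψ χ = 0) {χ : V} (hχ : ∀ j ∈ s, φ j χ = c j) :
    B ψ ψ ≤ B χ χ := by
  have h0 : B ψ (χ - ψ) = 0 :=
    horth _ (mem_annihilator.2 fun j hj => by simp [hψ j hj, hχ j hj])
  have h1 := hB.nonneg (χ - ψ)
  simp only [map_sub, sub_apply, hsymm χ ψ] at h0 h1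
  linarith

/-- A feasible quadratic minimization problem under linear constraints has a unique solution. -/
theorem existsUnique_minimizer [CompleteSpace V] (hB : IsCoercive B)
    (hsymm : ∀ u w, B u w = B w u) {s : Finset ι} {φ : ι → StrongDual ℝ V} {c : ι → ℝ}
    (hex : ∃ e, ∀ j ∈ s, φ j e = c j) :
    ∃! ψ, (∀ j ∈ s, φ j ψ = c j) ∧ ∀ χ, (∀ j ∈ s, φ j χ = c j) → B ψ ψ ≤ B χ χ := by
  obtain ⟨e, he⟩ := hex
  let K := annihilator s φ
  have : CompleteSpace K := (isClosed_annihilator s φ).completeSpace_coe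
  have hBK : IsCoercive (B.bilinearComp K.subtypeL K.subtypeL) := by
    obtain ⟨C, hC0, hC⟩ := hB
    exact ⟨C, hC0, fun u => hC u⟩
  obtain ⟨w, hw⟩ := hBK.exists_forall_eq ((B e).comp K.subtypeL)
  have hadm : ∀ j ∈ s, φ j (e - w) = c j := fun j hj => by
    rw [map_sub, he j hj, mem_annihilator.1 w.2 j hj, sub_zero]
  refine ⟨e - w, ⟨hadm, fun χ hχ => minimizer_of_orthogonal hB hsymm hadm (fun χ hχ => ?_) hχ⟩, ?_⟩
  · have := hw ⟨χ, hχ⟩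
    rw [map_sub, sub_apply, sub_eq_zero]
    exact this.symm
  · rintro ψ ⟨h1, h2⟩
    have hd : ψ - (e - w) ∈ annihilator s φ :=
      mem_annihilator.2 fun j hj => by rw [map_sub, h1 j hj, hadm j hj, sub_self]
    refine sub_eq_zero.1 (hB.eq_zero ?_)
    have e1 := minimizer_orthogonal hsymm h1 h2 hd
    have e2 := hw ⟨_, hd⟩
    have e3 : B (e - w) (ψ - (e - w)) = 0 := by
      rw [map_sub B, sub_apply, sub_eq_zero]
      exact e2.symm
    rw [map_sub B, sub_apply, e1, e3, sub_zero]

variable {s : Finset ι} {φ : ι → StrongDual ℝ V} {ψ : ι → V}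

/-- The interpolation of a functional from its values on the dual basis. -/
def interp (s : Finset ι) (φ : ι → StrongDual ℝ V) (ψ : ι → V) (f : StrongDual ℝ V) :
    StrongDual ℝ V :=
  ∑ i ∈ s, f (ψ i) • φ i

theorem interp_mem_span (f : StrongDual ℝ V) :
    interp s φ ψ f ∈ Submodule.span ℝ (φ '' s) :=
  Submodule.sum_mem _ fun i hi => Submodule.smul_mem _ _ (Submodule.subset_span ⟨i, hi, rfl⟩)

theorem apply_eq_zero_of_mem_span {g : StrongDual ℝ V} (hg : g ∈ Submodule.span ℝ (φ '' s))
    {χ : V} (hχ : χ ∈ annihilator s φ) : g χ = 0 := by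
  induction hg using Submodule.span_induction with
  | mem g hg => obtain ⟨j, hj, rfl⟩ := hg; exact mem_annihilator.1 hχ j hj
  | zero => rfl
  | add g g' _ _ h h' => rw [add_apply, h, h', add_zero]
  | smul c g _ h => rw [smul_apply, h, smul_zero]

/-- `ψ` is dual to the measurements `φ` and orthogonal to their annihilator. -/
structure IsDualBasis [DecidableEq ι] (B : V →L[ℝ] V →L[ℝ] ℝ) (s : Finset ι)
    (φ : ι → StrongDual ℝ V) (ψ : ι → V) : Prop where
  apply_eq : ∀ i ∈ s, ∀ j ∈ s, φ j (ψ i) = if i = j then 1 else 0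
  orthogonal : ∀ i ∈ s, ∀ χ ∈ annihilator s φ, B (ψ i) χ = 0

variable [DecidableEq ι]

/-- By duality the sum has the same measurements as `u`. The difference thus lies in the annihilator
and is also orthogonal to it, so its energy is zero. -/
theorem IsDualBasis.eq_sum (h : IsDualBasis B s φ ψ) (hB : IsCoercive B) {u : V}
    (hu : ∀ χ ∈ annihilator s φ, B u χ = 0) : u = ∑ i ∈ s, φ i u • ψ i := by
  have hmem : u - ∑ i ∈ s, φ i u • ψ i ∈ annihilator s φ := by
    refine mem_annihilator.2 fun j hj => ?_
    simp only [map_sub, map_sum, map_smul, smul_eq_mul]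
    rw [Finset.sum_eq_single_of_mem j hj fun i hi hij => by simp [h.apply_eq i hi j hj, hij],
      h.apply_eq j hj j hj]
    simp
  refine sub_eq_zero.1 (hB.eq_zero ?_)
  rw [map_sub B, sub_apply, hu _ hmem, map_sum]
  simp only [map_smul, sum_apply, smul_apply, smul_eq_mul]
  rw [Finset.sum_eq_zero fun i hi => by rw [h.orthogonal i hi _ hmem, mul_zero], sub_zero]

/-- A solution `u` with right-hand side in the span of the measurements is orthogonal to their
annihilator, so it is recovered from its measurements. Read on the dual side, `f - interp s φ ψ f`
vanishes at `u`. -/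
theorem IsDualBasis.interp_apply (h : IsDualBasis B s φ ψ) (hB : IsCoercive B)
    {g : StrongDual ℝ V} (hg : g ∈ Submodule.span ℝ (φ '' s)) {u : V} (hu : ∀ h, B u h = g h)
    (f : StrongDual ℝ V) : interp s φ ψ f u = f u := by
  conv_rhs => rw [h.eq_sum hB fun χ hχ => (hu χ).trans (apply_eq_zero_of_mem_span hg hχ)]
  simp [interp, mul_comm]

end Minimizers

/-! ### Conditioning the Gaussian field on one level of measurements -/

section GaussianField

variable {V ι S : Type*} [NormedAddCommGroup V] [InnerProductSpace ℝ V]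
  {mS : MeasurableSpace S} {P : Measure S} {B : V →L[ℝ] V →L[ℝ] ℝ} {v : StrongDual ℝ V → S → ℝ}
  {q : ℕ} {s : ℕ → Finset ι} {φ : ℕ → ι → StrongDual ℝ V} {ψ : ℕ → ι → V}

/-- `v` is a centered Gaussian random linear functional whose covariance operator is the inverse
of the operator associated with `B`. -/
structure IsInverseGaussianField (B : V →L[ℝ] V →L[ℝ] ℝ) (P : Measure S)
    (v : StrongDual ℝ V → S → ℝ) : Prop where
  measurable : ∀ g, Measurable (v g)
  linear : ∀ x, IsLinearMap ℝ fun g => v g x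
  gaussian : IsGaussianProcess v P
  mean : ∀ g, ∫ x, v g x ∂P = 0
  cov : ∀ f g u, (∀ h, B u h = g h) → cov[v f, v g; P] = f u

/-- The field `v` interpolated from the measurements `φ i`, `i ∈ s`. -/
def interpField (s : Finset ι) (φ : ι → StrongDual ℝ V) (ψ : ι → V)
    (v : StrongDual ℝ V → S → ℝ) (x : S) : V :=
  ∑ i ∈ s, v (φ i) x • ψ i

/-- The σ-algebra generated by the measurements `φ i`, `i ∈ s`, of `v`. -/
abbrev fieldSigma (s : Finset ι) (φ : ι → StrongDual ℝ V) (v : StrongDual ℝ V → S → ℝ) :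
    MeasurableSpace S :=
  MeasurableSpace.comap (fun x (i : s) => v (φ i) x) inferInstance

theorem IsInverseGaussianField.map_sum {α : Type*} (hv : IsInverseGaussianField B P v)
    (t : Finset α) (f : α → StrongDual ℝ V) (x : S) :
    v (∑ i ∈ t, f i) x = ∑ i ∈ t, v (f i) x :=
  _root_.map_sum (hv.linear x).mk' f t

theorem IsInverseGaussianField.map_sub (hv : IsInverseGaussianField B P v)
    (f g : StrongDual ℝ V) (x : S) : v (f - g) x = v f x - v g x :=
  (hv.linear x).map_sub f g

/-- Transposes interpolation from the random element to the functional, so that statements about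
`interpField` become statements about `v` itself. -/
theorem IsInverseGaussianField.apply_interpField (hv : IsInverseGaussianField B P v)
    (s : Finset ι) (φ : ι → StrongDual ℝ V) (ψ : ι → V) (f : StrongDual ℝ V) (x : S) :
    f (interpField s φ ψ v x) = v (interp s φ ψ f) x := by
  rw [interpField, interp, hv.map_sum, _root_.map_sum]
  refine Finset.sum_congr rfl fun i _ => ?_
  rw [(hv.linear x).map_smul, _root_.map_smul, smul_eq_mul, smul_eq_mul, mul_comm]

theorem fieldSigma_le (hv : IsInverseGaussianField B P v) (s : Finset ι)
    (φ : ι → StrongDual ℝ V) : fieldSigma s φ v ≤ mS :=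
  (measurable_pi_lambda _ fun _ => hv.measurable _).comap_le

/-- Linearity of `v` holds at every sample point, so measurability is exact and the σ-algebras need
no completion by null sets. -/
theorem measurable_fieldSigma (hv : IsInverseGaussianField B P v) {s : Finset ι}
    {φ : ι → StrongDual ℝ V} {f : StrongDual ℝ V} (hf : f ∈ Submodule.span ℝ (φ '' s)) :
    Measurable[fieldSigma s φ v] (v f) := by
  induction hf using Submodule.span_induction with
  | mem g hg =>
    obtain ⟨j, hj, rfl⟩ := hg
    exact (measurable_pi_apply (⟨j, hj⟩ : s)).comp
      (comap_measurable (fun x (i : s) => v (φ i) x))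
  | zero =>
    have : v 0 = fun _ => 0 := funext fun x => (hv.linear x).map_zero
    rw [this]
    exact measurable_const
  | add f g _ _ hf hg =>
    have : v (f + g) = v f + v g := funext fun x => (hv.linear x).map_add f g
    rw [this]
    exact hf.add hg
  | smul c f _ hf =>
    have : v (c • f) = c • v f := funext fun x => (hv.linear x).map_smul c f
    rw [this]
    exact hf.const_smul c

theorem fieldSigma_mono (hv : IsInverseGaussianField B P v) {s t : Finset ι}
    {φ θ : ι → StrongDual ℝ V} (h : ∀ i ∈ s, φ i ∈ Submodule.span ℝ (θ '' t)) :
    fieldSigma s φ v ≤ fieldSigma t θ v := by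
  refine Measurable.comap_le ?_
  exact @measurable_pi_lambda _ _ _ (fieldSigma t θ v) _ _
    fun i => measurable_fieldSigma hv (h i i.2)

theorem IsInverseGaussianField.memLp_two (hv : IsInverseGaussianField B P v)
    (f : StrongDual ℝ V) : MemLp (v f) 2 P :=
  (hv.gaussian.hasGaussianLaw_eval f).memLp_two

theorem IsInverseGaussianField.integrable [IsProbabilityMeasure P]
    (hv : IsInverseGaussianField B P v) (f : StrongDual ℝ V) : Integrable (v f) P :=
  (hv.memLp_two f).integrable (by norm_num)

variable [CompleteSpace V] [DecidableEq ι]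

theorem cov_sub_interp (hv : IsInverseGaussianField B P v) (hB : IsCoercive B) {s : Finset ι}
    {φ : ι → StrongDual ℝ V} {ψ : ι → V} (h : IsDualBasis B s φ ψ) {g : StrongDual ℝ V}
    (hg : g ∈ Submodule.span ℝ (φ '' s)) (f : StrongDual ℝ V) :
    cov[v (f - interp s φ ψ f), v g; P] = 0 := by
  obtain ⟨u, hu⟩ := hB.exists_forall_eq g
  rw [hv.cov _ _ u hu, sub_apply, h.interp_apply hB hg hu, sub_self]

/-- Conditioning on the measurements is interpolation. -/
theorem condExp_fieldSigma [IsProbabilityMeasure P] (hv : IsInverseGaussianField B P v)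
    (hB : IsCoercive B) {s : Finset ι}
    {φ : ι → StrongDual ℝ V} {ψ : ι → V} (h : IsDualBasis B s φ ψ) (f : StrongDual ℝ V) :
    P[v f | fieldSigma s φ v] =ᵐ[P] fun x => f (interpField s φ ψ v x) := by
  have hle := fieldSigma_le hv s φ
  let X : Unit → S → ℝ := fun _ => v (f - interp s φ ψ f)
  -- Residual and measurements are values of one Gaussian process, so zero covariance gives
  -- independence.
  have hind : IndepFun (fun x i => X i x) (fun x (i : s) => v (φ i) x) P := by
    refine IsGaussianProcess.indepFun_of_covariance_eq_zero ?_
      (fun _ => (hv.measurable _).aemeasurable) (fun _ => (hv.measurable _).aemeasurable)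
      fun _ i => cov_sub_interp hv hB h (Submodule.subset_span ⟨i, i.2, rfl⟩) f
    have h := hv.gaussian.comp_right
      (Sum.elim (fun _ : Unit => f - interp s φ ψ f) fun i : s => φ i)
    rwa [Sum.comp_elim] at h
  have hXle : MeasurableSpace.comap (fun x i => X i x) inferInstance ≤ mS :=
    (measurable_pi_lambda _ fun _ => hv.measurable _).comap_le
  have h1 := condExp_indep_eq (μ := P) hXle hle
    (f := v (f - interp s φ ψ f))
    (((measurable_pi_apply ()).comp (comap_measurable (fun x i => X i x))).stronglyMeasurable)
    hind
  have h2 : P[v (interp s φ ψ f) | fieldSigma s φ v] = v (interp s φ ψ f) :=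
    condExp_of_stronglyMeasurable hle
      (measurable_fieldSigma hv (interp_mem_span f)).stronglyMeasurable (hv.integrable _)
  have h3 : v f = v (interp s φ ψ f) + v (f - interp s φ ψ f) := by
    ext x
    rw [Pi.add_apply, hv.map_sub, add_sub_cancel]
  have h4 := condExp_add (μ := P) (hv.integrable (interp s φ ψ f))
    (hv.integrable (f - interp s φ ψ f)) (fieldSigma s φ v)
  rw [← h3] at h4
  -- The residual, being independent, contributes its mean, which is zero.
  filter_upwards [h1, h4] with x hx1 hx4
  rw [hx4, Pi.add_apply, hx1, h2, hv.mean, add_zero, hv.apply_interpField]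

end GaussianField

/-! ### Nested levels: martingale and independent increments -/

section Hierarchy

variable {V ι S : Type*} [NormedAddCommGroup V] [InnerProductSpace ℝ V]
  {mS : MeasurableSpace S} {P : Measure S} {B : V →L[ℝ] V →L[ℝ] ℝ} {v : StrongDual ℝ V → S → ℝ}
  {q : ℕ} {s : ℕ → Finset ι} {φ : ℕ → ι → StrongDual ℝ V} {ψ : ℕ → ι → V}

theorem mem_span_of_nested (hnest : ∀ k, 1 ≤ k → k < q → ∀ i ∈ s k,
      φ k i ∈ Submodule.span ℝ (φ (k + 1) '' s (k + 1))) {k l : ℕ} (hk : 1 ≤ k) (hkl : k ≤ l)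
    (hl : l ≤ q) : Submodule.span ℝ (φ k '' s k) ≤ Submodule.span ℝ (φ l '' s l) := by
  induction l, hkl using Nat.le_induction with
  | base => exact le_rfl
  | succ l hkl ih =>
    refine (ih (by omega)).trans (Submodule.span_le.2 ?_)
    rintro _ ⟨i, hi, rfl⟩
    exact hnest l (hk.trans hkl) (by omega) i hi

theorem apply_increment_interpField (hv : IsInverseGaussianField B P v) (f : StrongDual ℝ V)
    (k : ℕ) (x : S) :
    f (increment (fun k => interpField (s k) (φ k) (ψ k) v) k x) =
      v (increment (fun k => interp (s k) (φ k) (ψ k) f) k) x := by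
  unfold increment
  split_ifs
  · exact hv.apply_interpField _ _ _ _ _
  · rw [Pi.sub_apply, map_sub, hv.map_sub, hv.apply_interpField, hv.apply_interpField]

theorem isGaussianProcess_increment (hv : IsInverseGaussianField B P v) (k : ℕ) :
    IsGaussianProcess (fun (f : StrongDual ℝ V) x =>
      f (increment (fun k => interpField (s k) (φ k) (ψ k) v) k x)) P := by
  simp only [apply_increment_interpField hv]
  exact hv.gaussian.comp_right fun f => increment (fun k => interp (s k) (φ k) (ψ k) f) k

/-- A dual basis of a coarse level is interpolated from the one of a finer level. -/
theorem eq_sum_of_nested [DecidableEq ι] (hB : IsCoercive B)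
    (hψ : ∀ k ∈ Set.Icc 1 q, IsDualBasis B (s k) (φ k) (ψ k))
    (hnest : ∀ k, 1 ≤ k → k < q → ∀ i ∈ s k,
      φ k i ∈ Submodule.span ℝ (φ (k + 1) '' s (k + 1))) {k l : ℕ} (hk : 1 ≤ k) (hkl : k ≤ l)
    (hl : l ≤ q) {j : ι} (hj : j ∈ s k) :
    ψ k j = ∑ i ∈ s l, φ l i (ψ k j) • ψ l i := by
  -- What the fine measurements annihilate is annihilated by the coarse ones too, so the coarse
  -- gamblet is orthogonal to it.
  refine (hψ l ⟨by omega, hl⟩).eq_sum hB fun χ hχ => ?_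
  refine (hψ k ⟨hk, by omega⟩).orthogonal j hj χ (mem_annihilator.2 fun i hi => ?_)
  exact apply_eq_zero_of_mem_span
    (mem_span_of_nested hnest hk hkl hl (Submodule.subset_span ⟨i, hi, rfl⟩)) hχ

variable [CompleteSpace V] [DecidableEq ι]

/-- All levels are conditional expectations of the same variable `v f`, so this is the tower
property. -/
theorem martingale_interpField [IsProbabilityMeasure P] (hv : IsInverseGaussianField B P v)
    (hB : IsCoercive B) (hψ : ∀ k ∈ Set.Icc 1 q, IsDualBasis B (s k) (φ k) (ψ k))
    (𝓕 : Filtration (Set.Icc 1 q) mS)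
    (h𝓕 : ∀ k : Set.Icc 1 q, 𝓕 k = fieldSigma (s k) (φ k) v) (f : StrongDual ℝ V) :
    Martingale (fun (k : Set.Icc 1 q) x => f (interpField (s k) (φ k) (ψ k) v x)) 𝓕 P := by
  refine ⟨fun k => ?_, fun k l hkl => ?_⟩
  · simp only [hv.apply_interpField]
    have h := measurable_fieldSigma hv (interp_mem_span (s := s k) (φ := φ k) (ψ := ψ k) f)
    rw [← h𝓕 k] at h
    exact h.stronglyMeasurable
  · have hk := condExp_fieldSigma hv hB (hψ k k.2) f
    have hl := condExp_fieldSigma hv hB (hψ l l.2) f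
    rw [← h𝓕] at hk hl
    exact (condExp_congr_ae hl.symm).trans
      ((condExp_condExp_of_le (𝓕.mono hkl) (𝓕.le l)).trans hk)

/-- The increment at `l` is the residual of level `l - 1` minus that of level `l`. Since `k ≤ l -
1`, the increment at `k` is a combination of measurements at either level, hence uncorrelated with
both residuals. -/
theorem cov_increment_of_lt [IsProbabilityMeasure P] (hv : IsInverseGaussianField B P v)
    (hB : IsCoercive B) (hψ : ∀ k ∈ Set.Icc 1 q, IsDualBasis B (s k) (φ k) (ψ k))
    (hnest : ∀ k, 1 ≤ k → k < q → ∀ i ∈ s k,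
      φ k i ∈ Submodule.span ℝ (φ (k + 1) '' s (k + 1)))
    {k l : ℕ} (hk : 1 ≤ k) (hkl : k < l) (hl : l ≤ q) (f g : StrongDual ℝ V) :
    cov[v (increment (fun k => interp (s k) (φ k) (ψ k) f) l),
      v (increment (fun k => interp (s k) (φ k) (ψ k) g) k); P] = 0 := by
  have hmem : ∀ m, k ≤ m → m ≤ q → increment (fun k => interp (s k) (φ k) (ψ k) g) k ∈
      Submodule.span ℝ (φ m '' s m) := by
    intro m hkm hm
    unfold increment
    split_ifs with h1
    · exact mem_span_of_nested hnest le_rfl (by omega) hm (interp_mem_span g)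
    · exact Submodule.sub_mem _ (mem_span_of_nested hnest hk hkm hm (interp_mem_span g))
        (mem_span_of_nested hnest (by omega) (by omega) hm (interp_mem_span g))
  have hl1 : l ≠ 1 := by omega
  have h1 := cov_sub_interp hv hB (hψ (l - 1) ⟨by omega, by omega⟩)
    (hmem (l - 1) (by omega) (by omega)) f
  have h2 := cov_sub_interp hv hB (hψ l ⟨by omega, by omega⟩)
    (hmem l (by omega) (by omega)) f
  have h3 : v (increment (fun k => interp (s k) (φ k) (ψ k) f) l) =
      v (f - interp (s (l - 1)) (φ (l - 1)) (ψ (l - 1)) f) -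
        v (f - interp (s l) (φ l) (ψ l) f) := by
    ext x
    rw [Pi.sub_apply, ← hv.map_sub, increment, if_neg hl1, sub_sub_sub_cancel_left]
  rw [h3, covariance_sub_left (hv.memLp_two _) (hv.memLp_two _) (hv.memLp_two _), h1, h2, sub_zero]

theorem iIndepFun_increment [IsProbabilityMeasure P] (hv : IsInverseGaussianField B P v)
    (hB : IsCoercive B) (hψ : ∀ k ∈ Set.Icc 1 q, IsDualBasis B (s k) (φ k) (ψ k))
    (hnest : ∀ k, 1 ≤ k → k < q → ∀ i ∈ s k,
      φ k i ∈ Submodule.span ℝ (φ (k + 1) '' s (k + 1))) :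
    iIndepFun (fun (k : Set.Icc 1 q) x (f : StrongDual ℝ V) =>
      f (increment (fun k => interpField (s k) (φ k) (ψ k) v) k x)) P := by
  simp only [apply_increment_interpField hv]
  refine IsGaussianProcess.iIndepFun_of_covariance_eq_zero
    (X := fun (k : Set.Icc 1 q) (f : StrongDual ℝ V) =>
      v (increment (fun k => interp (s k) (φ k) (ψ k) f) k)) ?_
    (fun _ _ => (hv.measurable _).aemeasurable) fun k l hkl f g => ?_
  · exact hv.gaussian.comp_right fun p : (_ : Set.Icc 1 q) × StrongDual ℝ V =>
      increment (fun k => interp (s k) (φ k) (ψ k) p.2) p.1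
  · rcases lt_or_gt_of_ne hkl with h | h
    · rw [covariance_comm]
      exact cov_increment_of_lt hv hB hψ hnest k.2.1 h l.2.2 g f
    · exact cov_increment_of_lt hv hB hψ hnest l.2.1 h k.2.2 f g

end Hierarchy

/-! ### Indicator functions of convex cells as measurements -/

section

variable {d : ℕ} {Ω : Set (EuclideanSpace ℝ (Fin d))}
  {a : EuclideanSpace ℝ (Fin d) → Matrix (Fin d) (Fin d) ℝ} {lmin lmax : ℝ}

/-- Convex sets are null measurable, so no measurability of the cells has to be assumed. -/
theorem memLp_indicator_one (hΩb : Bornology.IsBounded Ω) {t : Set (EuclideanSpace ℝ (Fin d))}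
    (ht : Convex ℝ t) : MemLp (t.indicator fun _ => (1 : ℝ)) 2 (volume.restrict Ω) := by
  have : IsFiniteMeasure (volume.restrict Ω) := ⟨by simpa using hΩb.measure_lt_top⟩
  refine MemLp.of_bound (aestronglyMeasurable_const.indicator₀
    ((ht.nullMeasurableSet volume).mono_ac Measure.restrict_le_self.absolutelyContinuous)) 1
    (.of_forall fun x => ?_)
  exact (norm_indicator_le_norm_self _ _).trans (by simp)

theorem indicatorFunctional_apply (hΩb : Bornology.IsBounded Ω)
    {t : Set (EuclideanSpace ℝ (Fin d))} (ht : Convex ℝ t) (u : H10 Ω) :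
    indicatorFunctional Ω t u = ∫ x in Ω, t.indicator (fun _ => (1 : ℝ)) x * valFn u x := by
  have h := memLp_indicator_one hΩb ht
  have h1 : indicatorFunctional Ω t u = inner ℝ (h.toLp _) (valFn u) := by
    rw [indicatorFunctional, dif_pos h]
    rfl
  rw [h1, L2.inner_def]
  refine integral_congr_ae ?_
  filter_upwards [h.coeFn_toLp] with x hx
  rw [hx]
  simp [mul_comm]

theorem integrable_indicator_mul (hΩb : Bornology.IsBounded Ω)
    {t : Set (EuclideanSpace ℝ (Fin d))} (ht : Convex ℝ t) (u : H10 Ω) :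
    Integrable (fun x => t.indicator (fun _ => (1 : ℝ)) x * valFn u x) (volume.restrict Ω) :=
  (memLp_indicator_one hΩb ht).integrable_mul (Lp.memLp (valFn u))

theorem indicatorFunctional_biUnion {ι : Type*} (hΩb : Bornology.IsBounded Ω)
    {t : Set (EuclideanSpace ℝ (Fin d))} (ht : Convex ℝ t) (s : Finset ι)
    (τ : ι → Set (EuclideanSpace ℝ (Fin d))) (hτ : ∀ j ∈ s, Convex ℝ (τ j))
    (hdisj : (s : Set ι).PairwiseDisjoint τ) (hU : t = ⋃ j ∈ s, τ j) :
    indicatorFunctional Ω t = ∑ j ∈ s, indicatorFunctional Ω (τ j) := by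
  ext u
  rw [sum_apply, indicatorFunctional_apply hΩb ht,
    Finset.sum_congr rfl fun j hj => indicatorFunctional_apply hΩb (hτ j hj) u,
    ← integral_finsetSum _ fun j hj => integrable_indicator_mul hΩb (hτ j hj) u]
  refine integral_congr_ae (.of_forall fun x => ?_)
  simp only
  rw [hU, Finset.indicator_biUnion s τ hdisj, Finset.sum_mul]

/-- Test functions belong to `H¹₀(Ω)`. -/
theorem exists_valFn_ae_eq {φ : EuclideanSpace ℝ (Fin d) → ℝ} (hφ : ContDiff ℝ ∞ φ)
    (hc : HasCompactSupport φ) (hs : tsupport φ ⊆ Ω) :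
    ∃ u : H10 Ω, valFn u =ᵐ[volume.restrict Ω] φ := by
  have h1 : MemLp φ 2 (volume.restrict Ω) :=
    (hφ.continuous.memLp_of_hasCompactSupport hc).restrict Ω
  have hgc : Continuous (gradient φ) :=
    (InnerProductSpace.toDual ℝ _).symm.continuous.comp (hφ.continuous_fderiv (by simp))
  have h2 : MemLp (gradient φ) 2 (volume.restrict Ω) :=
    (hgc.memLp_of_hasCompactSupport (hasCompactSupport_gradient hc)).restrict Ω
  refine ⟨⟨WithLp.toLp 2 (h1.toLp φ, h2.toLp (gradient φ)),
    Submodule.le_topologicalClosure _ (Submodule.subset_span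
      ⟨φ, hφ, hc, hs, h1.coeFn_toLp, h2.coeFn_toLp⟩)⟩, h1.coeFn_toLp⟩

/-- A nonnegative test function supported in a ball has integral one after normalization, hence
it separates a set containing this ball from the sets disjoint from it. -/
theorem exists_indicatorFunctional_eq {ι : Type*} [DecidableEq ι] (hΩb : Bornology.IsBounded Ω)
    (s : Finset ι) (τ : ι → Set (EuclideanSpace ℝ (Fin d))) (hτ : ∀ j ∈ s, Convex ℝ (τ j))
    (hdisj : (s : Set ι).PairwiseDisjoint τ) (hsub : ∀ j ∈ s, τ j ⊆ Ω) {i : ι} (hi : i ∈ s)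
    {c : EuclideanSpace ℝ (Fin d)} {r : ℝ} (hr : 0 < r) (hball : Metric.ball c r ⊆ τ i) :
    ∃ u : H10 Ω, ∀ j ∈ s, indicatorFunctional Ω (τ j) u = if i = j then 1 else 0 := by
  -- Outer radius `r / 2` keeps the closed support inside the open ball of radius `r`.
  let f : ContDiffBump c := ⟨r / 4, r / 2, by positivity, by linarith⟩
  have hfs : tsupport f ⊆ τ i := by
    rw [f.tsupport_eq]
    exact (Metric.closedBall_subset_ball (half_lt_self hr)).trans hball
  obtain ⟨u, hu⟩ := exists_valFn_ae_eq (φ := f) f.contDiff f.hasCompactSupport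
    (hfs.trans (hsub i hi))
  have hpos : 0 < ∫ x, f x := f.integral_pos
  refine ⟨(∫ x, f x)⁻¹ • u, fun j hj => ?_⟩
  rw [map_smul, smul_eq_mul, indicatorFunctional_apply hΩb (hτ j hj)]
  have hcongr : ∫ x in Ω, (τ j).indicator (fun _ => (1 : ℝ)) x * valFn u x =
      ∫ x in Ω, (τ j).indicator (fun _ => (1 : ℝ)) x * f x :=
    integral_congr_ae (hu.mono fun x hx => by simp only [hx])
  rw [hcongr]
  split_ifs with hij
  · subst hij
    rw [setIntegral_eq_integral_of_forall_compl_eq_zero]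
    · have : (fun x => (τ i).indicator (fun _ => (1 : ℝ)) x * f x) = f := by
        ext x
        by_cases hx : x ∈ τ i
        · simp [hx]
        · simp [image_eq_zero_of_notMem_tsupport fun h => hx (hfs h)]
      rw [this, inv_mul_cancel₀ hpos.ne']
    · intro x hx
      simp [image_eq_zero_of_notMem_tsupport fun h => hx (hsub i hi (hfs h))]
  · have : (fun x => (τ j).indicator (fun _ => (1 : ℝ)) x * f x) = fun _ => 0 := by
      ext x
      by_cases hx : x ∈ τ j
      · have : x ∉ tsupport f := fun h =>
          Set.disjoint_left.1 (hdisj hi hj hij) (hfs h) hx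
        simp [image_eq_zero_of_notMem_tsupport this]
      · simp [hx]
    rw [this]
    simp

section Cells

variable {q : ℕ} {I : Finset (List ℕ)} {δ : ℝ} {H : ℕ → ℝ}
  {τ : ℕ → List ℕ → Set (EuclideanSpace ℝ (Fin d))}

theorem IsNestedPartition.exists_admissible (hτ : IsNestedPartition Ω q I δ H τ)
    (hΩb : Bornology.IsBounded Ω) {k : ℕ} (hk : k ∈ Set.Icc 1 q) {i : List ℕ}
    (hi : i ∈ level I k) : ∃ u : H10 Ω, Admissible Ω I τ k i u := by
  obtain ⟨c, hc⟩ := hτ.ball_subset k hk i hi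
  have hr : 0 < δ * H k / 2 := by
    have h1 := hτ.delta_mem.1
    have h2 := (hτ.H_mem k hk).1
    positivity
  refine exists_indicatorFunctional_eq hΩb (level I k) (τ k) (hτ.convex k hk)
    (hτ.disjoint k hk) (fun j hj => ?_) hi hr hc
  rw [← hτ.cover k hk]
  exact Set.subset_biUnion_of_mem (u := τ k) (Finset.mem_coe.2 hj)

theorem IsNestedPartition.meas_mem_span (hτ : IsNestedPartition Ω q I δ H τ)
    (hΩb : Bornology.IsBounded Ω) (k : ℕ) (hk : 1 ≤ k) (hkq : k < q) (i : List ℕ)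
    (hi : i ∈ level I k) :
    meas Ω τ k i ∈ Submodule.span ℝ (meas Ω τ (k + 1) '' level I (k + 1)) := by
  have hk1 : k + 1 ∈ Set.Icc 1 q := ⟨by omega, by omega⟩
  rw [meas, indicatorFunctional_biUnion hΩb (hτ.convex k ⟨hk, hkq.le⟩ i hi)
    ((level I (k + 1)).filter fun j => j.take k = i) (τ (k + 1))
    (fun j hj => hτ.convex _ hk1 j (Finset.mem_filter.1 hj).1)
    ((hτ.disjoint _ hk1).subset fun j hj =>
      (Finset.mem_filter.1 (Finset.mem_coe.1 hj)).1) (hτ.nested k hk hkq i hi)]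
  exact Submodule.sum_mem _ fun j hj =>
    Submodule.subset_span ⟨j, (Finset.mem_filter.1 hj).1, rfl⟩

end Cells

/-- Functions that agree almost everywhere on an open set agree at its points of continuity. -/
theorem eq_of_ae_eq_of_continuousAt {X : Type*} [TopologicalSpace X] [MeasurableSpace X]
    {μ : Measure X} [μ.IsOpenPosMeasure] {U : Set X} (hU : IsOpen U) {f g : X → ℝ}
    (h : ∀ᵐ x ∂μ, x ∈ U → f x = g x) {x : X} (hx : x ∈ U) (hf : ContinuousAt f x)
    (hg : ContinuousAt g x) : f x = g x := by
  by_contra hne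
  obtain ⟨W, hW, hWo, hxW⟩ := eventually_nhds_iff.1 ((hf.ne_iff_eventually_ne hg).1 hne)
  rw [ae_iff] at h
  have h0 : μ (W ∩ U) = 0 := by
    refine measure_mono_null (fun y hy => ?_) h
    exact fun h' => hW y hy.1 (h' hy.2)
  exact ((hWo.inter hU).measure_pos μ ⟨x, hxW, hx⟩).ne' h0

end

/-! ### From the SPDE and the gamblets to the abstract setting -/

theorem covariance_congr_ae {S : Type*} {mS : MeasurableSpace S} {P : Measure S}
    {X X' Y Y' : S → ℝ} (hX : X =ᵐ[P] X') (hY : Y =ᵐ[P] Y') : cov[X, Y; P] = cov[X', Y'; P] := by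
  unfold covariance
  rw [integral_congr_ae hX, integral_congr_ae hY]
  refine integral_congr_ae ?_
  filter_upwards [hX, hY] with x h1 h2
  rw [h1, h2]

variable {d : ℕ} {Ω : Set (EuclideanSpace ℝ (Fin d))}
  {a : EuclideanSpace ℝ (Fin d) → Matrix (Fin d) (Fin d) ℝ}
  {B : H10 Ω →L[ℝ] H10 Ω →L[ℝ] ℝ}

set_option maxHeartbeats 2000000 in
theorem IsSPDESolution.isInverseGaussianField (hB : IsCoercive B)
    (hBE : ∀ u w, B u w = energy Ω a u w) {S : Type*} [MeasurableSpace S] {P : Measure S}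
    {ξ : H10 Ω → S → ℝ} (hξ : IsGaussianForcing Ω a P ξ) {v : HMinus1 Ω → S → ℝ}
    (hv : IsSPDESolution Ω a P ξ v) : IsInverseGaussianField B P v := by
  choose G hG using hB.exists_forall_eq
  have hsol : ∀ (u : H10 Ω) (g : HMinus1 Ω), (∀ h, B u h = g h) → v g =ᵐ[P] ξ u :=
    fun u g h => hv.solves u g fun w => (hBE u w).symm.trans (h w)
  refine ⟨hv.measurable, hv.linear, ?_, fun g => ?_, fun f g u hu => ?_⟩
  -- `G` is the solution operator. Almost sure equality at each index separately suffices, since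
  -- Gaussianity only involves finite-dimensional laws.
  · exact (hξ.gaussian.comp_right G).congr fun g => (hsol (G g) g (hG g)).symm
  · rw [integral_congr_ae (hsol (G g) g (hG g)), hξ.mean]
  · rw [covariance_congr_ae (hsol (G f) f (hG f)) (hsol u g hu), hξ.cov, ← hBE, hG]

variable {I : Finset (List ℕ)} {τ : ℕ → List ℕ → Set (EuclideanSpace ℝ (Fin d))}

set_option maxHeartbeats 2000000 in
theorem isGamblet_iff (hB : IsCoercive B) (hBE : ∀ u w, B u w = energy Ω a u w) {k : ℕ}
    {i : List ℕ} {ψ : H10 Ω} :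
    IsGamblet Ω a I τ k i ψ ↔ (∀ j ∈ level I k, meas Ω τ k j ψ = if i = j then 1 else 0) ∧
      ∀ χ : H10 Ω, (∀ j ∈ level I k, meas Ω τ k j χ = if i = j then 1 else 0) →
        B ψ ψ ≤ B χ χ := by
  refine and_congr Iff.rfl (forall_congr' fun χ => imp_congr Iff.rfl ?_)
  rw [energyNorm, energyNorm, ← hBE, ← hBE, Real.sqrt_le_sqrt_iff (hB.nonneg χ)]

theorem isDualBasis_of_isGamblet (hB : IsCoercive B) (hBE : ∀ u w, B u w = energy Ω a u w)
    (hsymm : ∀ u w, B u w = B w u) {k : ℕ} {ψ : List ℕ → H10 Ω}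
    (hψ : ∀ i ∈ level I k, IsGamblet Ω a I τ k i (ψ i)) :
    IsDualBasis B (level I k) (meas Ω τ k) ψ where
  apply_eq i hi := (hψ i hi).1
  orthogonal i hi _ hχ :=
    have h := (isGamblet_iff hB hBE).1 (hψ i hi)
    minimizer_orthogonal hsymm h.1 h.2 hχ

theorem valFn_sum_smul_ae_eq {ι : Type*} (s : Finset ι) (c : ι → ℝ) (ψ : ι → H10 Ω)
    {ψ' : ι → EuclideanSpace ℝ (Fin d) → ℝ}
    (h : ∀ i ∈ s, ψ' i =ᵐ[volume.restrict Ω] valFn (ψ i)) :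
    valFn (∑ i ∈ s, c i • ψ i) =ᵐ[volume.restrict Ω] fun x => ∑ i ∈ s, c i * ψ' i x := by
  have h0 : valFn (∑ i ∈ s, c i • ψ i) = ∑ i ∈ s, c i • valFn (ψ i) := by
    have := map_sum ((WithLp.fstL 2 ℝ (Lp ℝ 2 (volume.restrict Ω))
      (Lp (EuclideanSpace ℝ (Fin d)) 2 (volume.restrict Ω))).comp (H10 Ω).subtypeL)
      (fun i => c i • ψ i) s
    simp only [map_smul] at this
    exact this
  rw [h0]
  have h1 : ∀ᵐ x ∂volume.restrict Ω, ∀ i ∈ s, ψ' i x = valFn (ψ i) x :=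
    (ae_ball_iff s.countable_toSet).2 h
  have h2 : ∀ᵐ x ∂volume.restrict Ω, ∀ i ∈ s, (c i • valFn (ψ i)) x = c i * valFn (ψ i) x :=
    (ae_ball_iff s.countable_toSet).2 fun i _ => Lp.coeFn_smul _ _
  filter_upwards [Lp.coeFn_fun_finsetSum s fun i => c i • valFn (ψ i), h1, h2] with x hx hx1 hx2
  rw [hx]
  exact Finset.sum_congr rfl fun i hi => by rw [hx2 i hi, hx1 i hi]

end Gamblets

/-! ### Assembly and pointwise values -/

open Gamblets

set_option maxHeartbeats 2000000 in
theorem mainTheorem7 {d : ℕ} (hd : 0 < d)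
    (Ω : Set (EuclideanSpace ℝ (Fin d))) (hΩo : IsOpen Ω) (hΩb : Bornology.IsBounded Ω)
    (a : EuclideanSpace ℝ (Fin d) → Matrix (Fin d) (Fin d) ℝ) (lmin lmax : ℝ)
    (ha : IsUniformlyElliptic Ω a lmin lmax)
    (q : ℕ) (I : Finset (List ℕ)) (δ : ℝ) (H : ℕ → ℝ)
    (τ : ℕ → List ℕ → Set (EuclideanSpace ℝ (Fin d)))
    (hτ : IsNestedPartition Ω q I δ H τ)
    {S : Type*} [mS : MeasurableSpace S] (P : Measure S) [IsProbabilityMeasure P]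
    (ξ : H10 Ω → S → ℝ) (hξ : IsGaussianForcing Ω a P ξ)
    (v : HMinus1 Ω → S → ℝ) (hv : IsSPDESolution Ω a P ξ v) :
    -- the gamblets exist and are unique
    (∀ k ∈ Set.Icc 1 q, ∀ i ∈ level I k, ∃! ψ : H10 Ω, IsGamblet Ω a I τ k i ψ) ∧
    ∀ ψ : ℕ → List ℕ → H10 Ω,
      (∀ k ∈ Set.Icc 1 q, ∀ i ∈ level I k, IsGamblet Ω a I τ k i (ψ k i)) →
      -- the conditional expectation of the field `v` given `𝓕_k`
      (∀ k ∈ Set.Icc 1 q, ∀ f : HMinus1 Ω,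
        Integrable (v f) P ∧
        P[v f | measSigma Ω I τ v k] =ᵐ[P] fun s => f (vLevel Ω I τ v ψ k s)) ∧
      -- `𝓕_1, …, 𝓕_q` is a filtration
      ∃ 𝓕 : Filtration (Set.Icc 1 q) mS,
        (∀ k : Set.Icc 1 q, 𝓕 k = measSigma Ω I τ v k) ∧
        -- the field `v^(k)` is a martingale
        (∀ f : HMinus1 Ω,
          Martingale (fun (k : Set.Icc 1 q) s => f (vLevel Ω I τ v ψ k s)) 𝓕 P) ∧
        -- `v^(1)` and the increments are Gaussian fields, and they are independent
        (∀ k : Set.Icc 1 q,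
          IsGaussianProcess
            (fun (f : HMinus1 Ω) s => f (increment (vLevel Ω I τ v ψ) k s)) P) ∧
        iIndepFun (fun (k : Set.Icc 1 q) s (f : HMinus1 Ω) =>
          f (increment (vLevel Ω I τ v ψ) k s)) P ∧
        -- the same for the values `v^(k)(x)`, for any choice of representatives of the gamblets
        ∀ ψ' : ℕ → List ℕ → EuclideanSpace ℝ (Fin d) → ℝ,
          (∀ k ∈ Set.Icc 1 q, ∀ i ∈ level I k,
            ψ' k i =ᵐ[volume.restrict Ω] valFn (ψ k i)) →
          ∃ N : Set (EuclideanSpace ℝ (Fin d)), volume N = 0 ∧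
            (∀ x ∈ Ω, (∀ k ∈ Set.Icc 1 q, ∀ i ∈ level I k, ContinuousAt (ψ' k i) x) → x ∉ N) ∧
            (∀ x ∈ Ω \ N,
              Martingale (fun (k : Set.Icc 1 q) => vPoint Ω I τ v ψ' k x) 𝓕 P) ∧
            (∀ k : Set.Icc 1 q,
              IsGaussianProcess (fun (x : ↥(Ω \ N)) s =>
                increment (fun j => vPoint Ω I τ v ψ' j x s) k) P) ∧
            iIndepFun (fun (k : Set.Icc 1 q) s (x : ↥(Ω \ N)) =>
              increment (fun j => vPoint Ω I τ v ψ' j x s) k) P := by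
  have hΩm := hΩo.measurableSet
  obtain ⟨B, hB, hBE⟩ := exists_coercive_energy hd hΩm hΩb ha
  have hsymm : ∀ u w, B u w = B w u := fun u w => by rw [hBE, hBE, energy_comm ha hΩm]
  have hvB := hv.isInverseGaussianField hB hBE hξ
  have hnest := hτ.meas_mem_span hΩb
  refine ⟨fun k hk i hi => ?_, fun ψ hψ => ?_⟩
  · simp only [isGamblet_iff hB hBE]
    exact existsUnique_minimizer hB hsymm (hτ.exists_admissible hΩb hk hi)
  have hdual : ∀ k ∈ Set.Icc 1 q, IsDualBasis B (level I k) (meas Ω τ k) (ψ k) := fun k hk =>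
    isDualBasis_of_isGamblet hB hBE hsymm (hψ k hk)
  let 𝓕 : Filtration (Set.Icc 1 q) mS :=
    { seq := fun k => measSigma Ω I τ v k
      mono' := fun k l hkl => fieldSigma_mono hvB fun i hi =>
        mem_span_of_nested hnest k.2.1 hkl l.2.2 (Submodule.subset_span ⟨i, hi, rfl⟩)
      le' := fun k => fieldSigma_le hvB _ _ }
  have hmart : ∀ f : HMinus1 Ω,
      Martingale (fun (k : Set.Icc 1 q) s => f (vLevel Ω I τ v ψ k s)) 𝓕 P :=
    martingale_interpField hvB hB hdual 𝓕 fun _ => rfl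
  have hgauss : ∀ k : Set.Icc 1 q, IsGaussianProcess
      (fun (f : HMinus1 Ω) s => f (increment (vLevel Ω I τ v ψ) k s)) P := fun k =>
    isGaussianProcess_increment hvB k
  have hindep : iIndepFun (fun (k : Set.Icc 1 q) s (f : HMinus1 Ω) =>
      f (increment (vLevel Ω I τ v ψ) k s)) P :=
    iIndepFun_increment hvB hB hdual hnest
  refine ⟨fun k hk f => ⟨hvB.integrable f, condExp_fieldSigma hvB hB (hdual k hk) f⟩, 𝓕,
    fun _ => rfl, hmart, hgauss, hindep, fun ψ' hψ' => ?_⟩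
  -- A substitute for evaluation at `x`, which need not be bounded on `H10 Ω`. It uses only the
  -- chosen representatives of the finest gamblets, in terms of which all coarser gamblets expand.
  let F : EuclideanSpace ℝ (Fin d) → HMinus1 Ω := fun x =>
    ∑ i ∈ level I q, ψ' q i x • meas Ω τ q i
  let good : EuclideanSpace ℝ (Fin d) → Prop := fun x =>
    ∀ k ∈ Set.Icc 1 q, ∀ j ∈ level I k, ψ' k j x = F x (ψ k j)
  have hF : ∀ x u, F x u = ∑ i ∈ level I q, meas Ω τ q i u * ψ' q i x := fun x u => by
    simp [F, mul_comm]
  have hae : ∀ k ∈ Set.Icc 1 q, ∀ j ∈ level I k, ∀ᵐ x, x ∈ Ω → ψ' k j x = F x (ψ k j) := by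
    intro k hk j hj
    have hq : q ∈ Set.Icc 1 q := ⟨hk.1.trans hk.2, le_rfl⟩
    have h1 := eq_sum_of_nested hB hdual hnest hk.1 hk.2 le_rfl hj
    have h2 := valFn_sum_smul_ae_eq (level I q) (fun i => meas Ω τ q i (ψ k j)) (ψ q) (hψ' q hq)
    rw [← h1] at h2
    refine (ae_restrict_iff' hΩm).1 ?_
    filter_upwards [hψ' k hk j hj, h2] with x hx1 hx2
    rw [hx1, hx2, hF]
  have hpoint : ∀ k ∈ Set.Icc 1 q, ∀ x, good x → ∀ s,
      vPoint Ω I τ v ψ' k x s = F x (vLevel Ω I τ v ψ k s) := by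
    intro k hk x hx s
    rw [vPoint, vLevel, map_sum]
    refine Finset.sum_congr rfl fun i hi => ?_
    rw [map_smul, smul_eq_mul, hx k hk i hi, mul_comm]
  have hN : ∀ x : ↥(Ω \ {x | x ∈ Ω ∧ ¬ good x}), good x := fun x => by
    by_contra h
    exact x.2.2 ⟨x.2.1, h⟩
  have hinc : ∀ (k : Set.Icc 1 q) (x : ↥(Ω \ {x | x ∈ Ω ∧ ¬ good x})) (s : S),
      increment (fun j => vPoint Ω I τ v ψ' j x s) k =
        F x (increment (vLevel Ω I τ v ψ) k s) := by
    intro k x s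
    have h := fun j hj => hpoint j hj x (hN x) s
    have hk := k.2
    unfold increment
    split_ifs with h1
    · exact h 1 ⟨le_rfl, h1 ▸ k.2.2⟩
    · rw [Pi.sub_apply, map_sub, ← h k hk, ← h (k - 1) ⟨by grind, by grind⟩]
  -- The exceptional set collects the points where some representative differs from its expansion in
  -- finest representatives: a finite union of null sets.
  refine ⟨{x | x ∈ Ω ∧ ¬ good x}, ?_, fun x hx hcont hxN => hxN.2 fun k hk j hj => ?_,
    fun x hx => ?_, fun k => ?_, ?_⟩
  · have h : ∀ᵐ x, ∀ k ∈ Set.Icc 1 q, ∀ j ∈ level I k, x ∈ Ω → ψ' k j x = F x (ψ k j) :=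
      (ae_ball_iff (Set.to_countable _)).2 fun k hk =>
        (ae_ball_iff (level I k).countable_toSet).2 (hae k hk)
    rw [ae_iff] at h
    refine measure_mono_null (fun x hx => ?_) h
    exact fun h => hx.2 fun k hk j hj => h k hk j hj hx.1
  · have hq : q ∈ Set.Icc 1 q := ⟨hk.1.trans hk.2, le_rfl⟩
    -- Both sides are continuous at `x` and agree almost everywhere in the open set `Ω`, so they
    -- agree at `x`.
    refine eq_of_ae_eq_of_continuousAt hΩo (hae k hk j hj) hx (hcont k hk j hj) ?_
    simp only [hF]
    exact tendsto_finsetSum _ fun i hi => (hcont q hq i hi).const_mul _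
  · have h : (fun (k : Set.Icc 1 q) => vPoint Ω I τ v ψ' k x) =
        fun (k : Set.Icc 1 q) s => F x (vLevel Ω I τ v ψ k s) :=
      funext fun k => funext fun s => hpoint k k.2 x (hN ⟨x, hx⟩) s
    rw [h]
    exact hmart (F x)
  · simp only [hinc]
    exact (hgauss k).comp_right fun x : ↥(Ω \ {x | x ∈ Ω ∧ ¬ good x}) => F x
  · simp only [hinc]
    -- The pointwise increments are coordinates, at the functionals `F x`, of the independent
    -- fields.
    exact hindep.comp (fun _ Y (x : ↥(Ω \ {x | x ∈ Ω ∧ ¬ good x})) => Y (F x)) fun _ =>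
      measurable_pi_lambda _ fun x => measurable_pi_apply (F x)
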